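/- Let $(M,d)$ be a compact metric space with a distinguished point $0\in M$. Let $\mathrm{Lip}_0(M)$ be the space of Lipschitz functions $f\colon M\to\mathbb R$ with $f(0)=0$, normed by the best Lipschitz constant $\|f\|_L=\sup_{x\ne y}|f(x)-f(y)|/d(x,y)$. Let $\delta(x)\in \mathrm{Lip}_0(M)^*$ denote evaluation at $x\in M$, and let $\mathcal F(M)=\overline{\mathrm{span}}^{\|\cdot\|}\{\delta(x):x\in M\}\subset \mathrm{Lip}_0(M)^*$ be the Lipschitz-free space over $M$; its dual is $\mathrm{Lip}_0(M)$, and "weak$^*$" refers to the topology $\sigma(\mathrm{Lip}_0(M),\mathcal F(M))$. Let $s_0(M)$ be the set of locally constant functions in $\mathrm{Lip}_0(M)$, and let $\lambda$ be the Lebesgue measure on $\mathbb R$. A set $S\subset \mathrm{Lip}_0(M)$ separates points of $M$ uniformly if there is $C\ge 1$ such that for all $x\neq y$ in $M$ there is $f\in S$ with $\|f\|_L\le C$ and $|f(x)-f(y)|=d(x,y)$. For a pointed metric space $N$ and a Lipschitz map $f\colon M\to N$ with $f(0)=0$, let $\widehat f\colon\mathcal F(M)\to\mathcal F(N)$ be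 the unique bounded linear operator with $\widehat f(\delta(x))=\delta(f(x))$ for all $x\in M$. Call $M$ Lip-lin injective if, for every pointed metric space $N$ and every injective Lipschitz map $f\colon M\to N$ with $f(0)=0$, the operator $\widehat f$ is injective. Then the following properties are equivalent: (i) $s_0(M)$ is weak$^*$-dense in $\mathrm{Lip}_0(M)$; (ii) the set $\{f\in \mathrm{Lip}_0(M):\lambda(f(M))=0\}$ is weak$^*$-dense in $\mathrm{Lip}_0(M)$; (iii) $s_0(M)$ separates points of $M$ uniformly; (iv) the set $\{f\in \mathrm{Lip}_0(M):\lambda(f(M))=0\}$ separates points of $M$ uniformly; (v) $M$ is Lip-lin injective and totally disconnected. -/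

import Mathlib

universe u v

/-- `Lip_0(M, N)` for metric spaces `M`, `N` with distinguished points `z`, `w`:
the Lipschitz maps that send `z` to `w`. -/
def Lip0Maps {M : Type u} {N : Type v} [MetricSpace M] [MetricSpace N] (z : M) (w : N) :
    Set (M → N) :=
  {f | (∃ K : NNReal, LipschitzWith K f) ∧ f z = w}

/-- The vector space of real-valued Lipschitz functions on `M` that vanish at `z`. -/
def lip0Submodule {M : Type u} [MetricSpace M] (z : M) : Submodule ℝ (M → ℝ) where
  carrier := Lip0Maps z (0 : ℝ)
  add_mem' := by
    rintro f g ⟨⟨K, hK⟩, hf⟩ ⟨⟨L, hL⟩, hg⟩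
    exact ⟨⟨K + L, hK.add hL⟩, by simp [hf, hg]⟩
  zero_mem' := ⟨⟨0, LipschitzWith.const 0⟩, rfl⟩
  smul_mem' := by
    rintro c f ⟨⟨K, hK⟩, hf⟩
    exact ⟨⟨‖c‖₊ * K, (lipschitzWith_smul c).comp hK⟩, by simp [hf]⟩

/-- `Lip_0(M)`. It is a type of its own, so that its topology is the one of the Lipschitz norm
and not the topology of pointwise convergence. -/
def Lip0 {M : Type u} [MetricSpace M] (z : M) : Type u := lip0Submodule z

namespace Lip0

variable {M : Type u} [MetricSpace M] {z : M}

instance : AddCommGroup (Lip0 z) := inferInstanceAs (AddCommGroup (lip0Submodule z))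

noncomputable instance : Module ℝ (Lip0 z) := inferInstanceAs (Module ℝ (lip0Submodule z))

instance : FunLike (Lip0 z) M ℝ where
  coe f := f.1
  coe_injective _ _ h := Subtype.ext h

theorem lipschitz (f : Lip0 z) : ∃ K : NNReal, LipschitzWith K f := f.2.1

theorem map_base (f : Lip0 z) : f z = 0 := f.2.2

theorem add_apply (f g : Lip0 z) (x : M) : (f + g) x = f x + g x := rfl

theorem smul_apply (c : ℝ) (f : Lip0 z) (x : M) : (c • f) x = c * f x := rfl

theorem zero_apply (x : M) : (0 : Lip0 z) x = 0 := rfl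

/-- The best Lipschitz constant, `sup |f x - f y| / d(x, y)`
(a pair with `x = y` contributes `0 / 0 = 0`). -/
noncomputable instance : Norm (Lip0 z) :=
  ⟨fun f => ⨆ p : M × M, |f p.1 - f p.2| / dist p.1 p.2⟩

theorem norm_def (f : Lip0 z) : ‖f‖ = ⨆ p : M × M, |f p.1 - f p.2| / dist p.1 p.2 := rfl

theorem bddAbove (f : Lip0 z) :
    BddAbove (Set.range fun p : M × M => |f p.1 - f p.2| / dist p.1 p.2) := by
  obtain ⟨K, hK⟩ := f.lipschitz
  refine ⟨K, ?_⟩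
  rintro _ ⟨p, rfl⟩
  refine div_le_of_le_mul₀ dist_nonneg K.2 ?_
  simpa [Real.dist_eq] using hK.dist_le_mul p.1 p.2

theorem norm_nonneg' (f : Lip0 z) : 0 ≤ ‖f‖ :=
  Real.iSup_nonneg fun _ => div_nonneg (abs_nonneg _) dist_nonneg

theorem abs_sub_le (f : Lip0 z) (x y : M) : |f x - f y| ≤ ‖f‖ * dist x y := by
  rcases eq_or_ne x y with rfl | h
  · simp
  · rw [← div_le_iff₀ (dist_pos.2 h)]
    exact le_ciSup f.bddAbove (x, y)

theorem norm_le {f : Lip0 z} {C : ℝ} (hC : 0 ≤ C) (h : ∀ x y, |f x - f y| ≤ C * dist x y) :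
    ‖f‖ ≤ C :=
  Real.iSup_le (fun p => div_le_of_le_mul₀ dist_nonneg hC (h p.1 p.2)) hC

theorem norm_add_le' (f g : Lip0 z) : ‖f + g‖ ≤ ‖f‖ + ‖g‖ := by
  refine norm_le (add_nonneg f.norm_nonneg' g.norm_nonneg') fun x y => ?_
  have h1 := f.abs_sub_le x y
  have h2 := g.abs_sub_le x y
  have h3 := abs_add_le (f x - f y) (g x - g y)
  rw [add_apply, add_apply, add_mul]
  calc _ = |f x - f y + (g x - g y)| := by ring_nf
    _ ≤ _ := by linarith

theorem norm_smul' (c : ℝ) (f : Lip0 z) : ‖c • f‖ = ‖c‖ * ‖f‖ := by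
  rw [norm_def, norm_def, Real.mul_iSup_of_nonneg (norm_nonneg c)]
  refine iSup_congr fun p => ?_
  rw [smul_apply, smul_apply, ← mul_sub, abs_mul, Real.norm_eq_abs, mul_div_assoc]

theorem norm_core : NormedSpace.Core ℝ (Lip0 z) where
  norm_nonneg := norm_nonneg'
  norm_smul := norm_smul'
  norm_triangle := norm_add_le'
  norm_eq_zero_iff f := by
    refine ⟨fun h => DFunLike.ext _ _ fun x => ?_, ?_⟩
    · have := f.abs_sub_le x z
      rw [h, zero_mul, map_base, sub_zero] at this
      exact abs_nonpos_iff.1 this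
    · rintro rfl
      exact le_antisymm (norm_le le_rfl fun x y => by simp [zero_apply]) (norm_nonneg' _)

noncomputable instance : NormedAddCommGroup (Lip0 z) := NormedAddCommGroup.ofCore norm_core

noncomputable instance : NormedSpace ℝ (Lip0 z) := NormedSpace.ofCore norm_core

end Lip0

section Free

variable {M : Type u} [MetricSpace M]

/-- The evaluation functional `δ(x)` on `Lip_0(M)`. -/
noncomputable def evalAt (z x : M) : StrongDual ℝ (Lip0 z) :=
  LinearMap.mkContinuous
    { toFun := fun f => f x
      map_add' := fun _ _ => rfl
      map_smul' := fun _ _ => rfl }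
    (dist x z) fun f => by
      have := f.abs_sub_le x z
      rw [Lip0.map_base, sub_zero] at this
      rw [mul_comm, Real.norm_eq_abs]
      exact this

theorem evalAt_apply (z x : M) (f : Lip0 z) : evalAt z x f = f x := rfl

/-- The Lipschitz-free space `F(M)`: the norm closed linear span of the evaluation functionals in
the dual of `Lip_0(M)`. -/
noncomputable def LipFree (z : M) : Submodule ℝ (StrongDual ℝ (Lip0 z)) :=
  (Submodule.span ℝ (Set.range (evalAt z))).topologicalClosure

theorem evalAt_mem (z x : M) : evalAt z x ∈ LipFree z :=
  Submodule.le_topologicalClosure _ (Submodule.subset_span ⟨x, rfl⟩)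

/-- The duality pairing `⟨f, μ⟩ = μ(f)` between `Lip_0(M)` and `F(M)`. -/
noncomputable def lipPairing (z : M) : Lip0 z →ₗ[ℝ] LipFree z →ₗ[ℝ] ℝ :=
  LinearMap.mk₂ ℝ (fun f μ => (μ : StrongDual ℝ (Lip0 z)) f)
    (fun f g μ => map_add μ.1 f g) (fun c f μ => map_smul μ.1 c f)
    (fun _ _ _ => rfl) (fun _ _ _ => rfl)

/-- Density in `Lip_0(M)` for the weak* topology, i.e. the coarsest topology for which all
the functions `f ↦ ⟨f, μ⟩` with `μ ∈ F(M)` are continuous. -/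
def WeakStarDense {z : M} (S : Set (Lip0 z)) : Prop :=
  Dense (X := WeakBilin (lipPairing z)) S

/-- `S` separates the points of `M` uniformly. -/
def SeparatesPointsUniformly {z : M} (S : Set (Lip0 z)) : Prop :=
  ∃ C : ℝ, 1 ≤ C ∧ ∀ x y : M, x ≠ y → ∃ f ∈ S, ‖f‖ ≤ C ∧ |f x - f y| = dist x y

/-- `s_0(M)`, the locally constant functions in `Lip_0(M)`. -/
def locConstLip0 (z : M) : Set (Lip0 z) := {f | IsLocallyConstant f}

/-- The functions in `Lip_0(M)` with Lebesgue-null image. -/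
def nullImageLip0 (z : M) : Set (Lip0 z) := {f | MeasureTheory.volume (Set.range f) = 0}

end Free

section Linearisation

variable {M : Type u} {N : Type v} [MetricSpace M] [MetricSpace N] {z : M} {w : N}

/-- The composition operator `C_f : Lip_0(N) → Lip_0(M)`, `g ↦ g ∘ f`. -/
noncomputable def compOp {f : M → N} (hf : f ∈ Lip0Maps z w) : Lip0 w →L[ℝ] Lip0 z :=
  LinearMap.mkContinuousOfExistsBound
    { toFun := fun g => ⟨g ∘ f, by
        obtain ⟨K, hK⟩ := hf.1
        obtain ⟨L, hL⟩ := g.lipschitz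
        exact ⟨⟨L * K, hL.comp hK⟩, by rw [Function.comp_apply, hf.2, g.map_base]⟩⟩
      map_add' := fun _ _ => rfl
      map_smul' := fun _ _ => rfl }
    (by
      obtain ⟨K, hK⟩ := hf.1
      refine ⟨K, fun g => Lip0.norm_le (mul_nonneg K.2 g.norm_nonneg') fun x y => ?_⟩
      calc |g (f x) - g (f y)| ≤ ‖g‖ * dist (f x) (f y) := g.abs_sub_le _ _
        _ ≤ ‖g‖ * (K * dist x y) :=
          mul_le_mul_of_nonneg_left (hK.dist_le_mul x y) g.norm_nonneg'
        _ = K * ‖g‖ * dist x y := by ring)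

theorem compOp_apply {f : M → N} (hf : f ∈ Lip0Maps z w) (g : Lip0 w) (x : M) :
    compOp hf g x = g (f x) := rfl

/-- The transpose `μ ↦ μ ∘ C_f` of the composition operator. -/
noncomputable def dualOp {f : M → N} (hf : f ∈ Lip0Maps z w) :
    StrongDual ℝ (Lip0 z) →L[ℝ] StrongDual ℝ (Lip0 w) :=
  ContinuousLinearMap.precomp ℝ (compOp hf)

theorem dualOp_evalAt {f : M → N} (hf : f ∈ Lip0Maps z w) (x : M) :
    dualOp hf (evalAt z x) = evalAt w (f x) := rfl

theorem dualOp_mem {f : M → N} (hf : f ∈ Lip0Maps z w) {μ : StrongDual ℝ (Lip0 z)}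
    (hμ : μ ∈ LipFree z) : dualOp hf μ ∈ LipFree w := by
  have h : Submodule.span ℝ (Set.range (evalAt z)) ≤
      (LipFree w).comap (dualOp hf).toLinearMap := by
    rw [Submodule.span_le]
    rintro _ ⟨x, rfl⟩
    exact evalAt_mem w (f x)
  refine Submodule.topologicalClosure_minimal _ h ?_ hμ
  exact (Submodule.isClosed_topologicalClosure _).preimage (dualOp hf).continuous

/-- The linearisation `F(M) → F(N)` of `f ∈ Lip_0(M, N)`: the bounded linear operator that
sends `δ(x)` to `δ(f(x))` for all `x`. -/
noncomputable def linearisation {f : M → N} (hf : f ∈ Lip0Maps z w) :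
    LipFree z →L[ℝ] LipFree w :=
  ((dualOp hf).comp (LipFree z).subtypeL).codRestrict (LipFree w) fun μ => dualOp_mem hf μ.2

theorem linearisation_evalAt {f : M → N} (hf : f ∈ Lip0Maps z w) (x : M) :
    linearisation hf ⟨evalAt z x, evalAt_mem z x⟩ = ⟨evalAt w (f x), evalAt_mem w (f x)⟩ := rfl

end Linearisation

/-- `M` (with distinguished point `z`) is Lip-lin injective: for every pointed metric space `N`,
every injective map in `Lip_0(M, N)` has an injective linearisation. -/
def LipLinInjective {M : Type u} [MetricSpace M] (z : M) : Prop :=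
  ∀ (N : Type (max u v)) [MetricSpace N] (w : N) (f : M → N) (hf : f ∈ Lip0Maps z w),
    Function.Injective f → Function.Injective (linearisation hf)

open Filter Topology MeasureTheory

section Basic

variable {M : Type u} [MetricSpace M] {z : M}

theorem Lip0.exists_eq_sub (z : M) {f : M → ℝ} {C : ℝ} (hC : 0 ≤ C)
    (hf : ∀ x y, |f x - f y| ≤ C * dist x y) :
    ∃ g : Lip0 z, (∀ x, g x = f x - f z) ∧ ‖g‖ ≤ C := by
  have hL : LipschitzWith C.toNNReal (fun x => f x - f z) :=
    LipschitzWith.of_dist_le_mul fun x y => by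
      simpa [Real.dist_eq, Real.coe_toNNReal C hC] using hf x y
  refine ⟨⟨fun x => f x - f z, ⟨_, hL⟩, sub_self _⟩, fun x => rfl, Lip0.norm_le hC fun x y => ?_⟩
  change |(f x - f z) - (f y - f z)| ≤ _
  simpa using hf x y

theorem Lip0.continuous (f : Lip0 z) : Continuous f :=
  f.lipschitz.choose_spec.continuous

theorem IsLocallyConstant.of_eventually_eq {X Y : Type*} [TopologicalSpace X] {f : X → Y}
    (h : ∀ x, ∀ᶠ y in 𝓝 x, f y = f x) : IsLocallyConstant f :=
  (IsLocallyConstant.iff_eventually_eq f).2 h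

/-- On bounded sets, pointwise convergence implies weak* convergence. -/
theorem LipFree.tendsto_apply {ι : Type*} {l : Filter ι} {h : ι → Lip0 z} {f : Lip0 z} {C : ℝ}
    (hb : ∀ i, ‖h i‖ ≤ C) (hp : ∀ x, Tendsto (fun i => h i x) l (𝓝 (f x)))
    {μ : StrongDual ℝ (Lip0 z)} (hμ : μ ∈ LipFree z) :
    Tendsto (fun i => μ (h i)) l (𝓝 (μ f)) := by
  have hspan : ∀ ν ∈ Submodule.span ℝ (Set.range (evalAt z)),
      Tendsto (fun i => ν (h i)) l (𝓝 (ν f)) := by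
    intro ν hν
    induction hν using Submodule.span_induction with
    | mem ν hν =>
      obtain ⟨x, rfl⟩ := hν
      exact hp x
    | zero => simpa using tendsto_const_nhds
    | add a b _ _ ha hb => exact ha.add hb
    | smul c a _ ha => exact ha.const_mul c
  rw [Metric.tendsto_nhds]
  intro ε hε
  have hD : 0 < |C| + ‖f‖ + 1 := by positivity
  obtain ⟨ν, hν, hμν⟩ := Metric.mem_closure_iff.1 hμ (ε / (2 * (|C| + ‖f‖ + 1))) (by positivity)
  filter_upwards [Metric.tendsto_nhds.1 (hspan ν hν) (ε / 2) (by positivity)] with i hi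
  have h1 : |(μ - ν) (h i - f)| ≤ ‖μ - ν‖ * ‖h i - f‖ := (μ - ν).le_opNorm _
  have h2 : ‖h i - f‖ ≤ |C| + ‖f‖ + 1 := by
    have := norm_sub_le (h i) f
    have := hb i
    have := le_abs_self C
    linarith
  have h3 : ‖μ - ν‖ * ‖h i - f‖ ≤ ε / 2 := by
    rw [dist_eq_norm] at hμν
    calc _ ≤ ε / (2 * (|C| + ‖f‖ + 1)) * (|C| + ‖f‖ + 1) := by gcongr
      _ = ε / 2 := by field_simp
  rw [Real.dist_eq] at hi ⊢
  have h4 : μ (h i) - μ f = (μ - ν) (h i - f) + (ν (h i) - ν f) := by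
    simp only [map_sub, sub_apply]; ring
  rw [h4]
  have := abs_add_le ((μ - ν) (h i - f)) (ν (h i) - ν f)
  linarith

theorem lipPairing_injective : Function.Injective (lipPairing z) := fun _ _ h =>
  DFunLike.ext _ _ fun x => LinearMap.congr_fun h ⟨evalAt z x, evalAt_mem z x⟩

theorem mem_weakStarClosure_of_tendsto {ι : Type*} {l : Filter ι} [l.NeBot] {h : ι → Lip0 z}
    {f : Lip0 z} {C : ℝ} {S : Set (Lip0 z)} (hS : ∀ i, h i ∈ S) (hb : ∀ i, ‖h i‖ ≤ C)
    (hp : ∀ x, Tendsto (fun i => h i x) l (𝓝 (f x))) :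
    f ∈ closure (X := WeakBilin (lipPairing z)) S := by
  have : @Tendsto ι (WeakBilin (lipPairing z)) h l (@nhds (WeakBilin (lipPairing z)) _ f) :=
    (WeakBilin.tendsto_iff_forall_eval_tendsto _ lipPairing_injective).2
      fun μ => LipFree.tendsto_apply hb hp μ.2
  exact mem_closure_of_tendsto (X := WeakBilin (lipPairing z)) this (Eventually.of_forall hS)

theorem WeakStarDense.eq_zero_of_forall {S : Set (Lip0 z)} (hS : WeakStarDense S)
    {μ : StrongDual ℝ (Lip0 z)} (hμ : μ ∈ LipFree z) (h : ∀ f ∈ S, μ f = 0) : μ = 0 := by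
  have hc : IsClosed (X := WeakBilin (lipPairing z)) {f : Lip0 z | μ f = 0} :=
    isClosed_singleton.preimage (WeakBilin.eval_continuous (lipPairing z) ⟨μ, hμ⟩)
  ext f
  exact hc.closure_subset_iff.2 h (hS f)

theorem LipFree.norm_evalAt_sub_le (x y : M) : ‖evalAt z x - evalAt z y‖ ≤ dist x y :=
  ContinuousLinearMap.opNorm_le_bound _ dist_nonneg fun f => by
    rw [mul_comm]; exact f.abs_sub_le x y

theorem LipFree.dist_le_norm_evalAt_sub (x y : M) : dist x y ≤ ‖evalAt z x - evalAt z y‖ := by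
  obtain ⟨g, hg, hg1⟩ := Lip0.exists_eq_sub z (f := fun u => dist u y) zero_le_one
    fun u v => by simpa using abs_dist_sub_le u v y
  have h1 : |(evalAt z x - evalAt z y) g| ≤ ‖evalAt z x - evalAt z y‖ * ‖g‖ :=
    (evalAt z x - evalAt z y).le_opNorm g
  have h2 : (evalAt z x - evalAt z y) g = dist x y := by
    change g x - g y = _
    simp [hg]
  rw [h2, abs_of_nonneg dist_nonneg] at h1
  exact h1.trans (mul_le_of_le_one_right (norm_nonneg _) hg1)

end Basic

section Flattening

/-- A short map of the line that is close to the identity and locally constant near a given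
null set. -/
theorem Real.exists_short_map_locally_constant {K : Set ℝ} (hK : volume K = 0) {ε : ℝ}
    (hε : 0 < ε) : ∃ φ : ℝ → ℝ, (∀ s t, |φ s - φ t| ≤ |s - t|) ∧ (∀ t, |φ t - t| ≤ ε) ∧
      ∀ t ∈ K, ∀ᶠ s in 𝓝 t, φ s = φ t := by
  obtain ⟨U, hKU, hU, hUε⟩ := K.exists_isOpen_lt_of_lt (ENNReal.ofReal ε)
    (by rw [hK]; exact ENNReal.ofReal_pos.2 hε)
  have hfin : ∀ A : Set ℝ, volume (U ∩ A) ≠ ⊤ := fun A =>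
    ((measure_mono Set.inter_subset_left).trans_lt (hUε.trans ENNReal.ofReal_lt_top)).ne
  have hsplit : ∀ s t : ℝ, s ≤ t → volume.real (U ∩ Set.Iic t)
      = volume.real (U ∩ Set.Iic s) + volume.real (U ∩ Set.Ioc s t) := fun s t hst => by
    rw [← measureReal_union _ (hU.measurableSet.inter measurableSet_Ioc) (hfin _) (hfin _),
      ← Set.inter_union_distrib_left, Set.Iic_union_Ioc_eq_Iic hst]
    exact (Set.Iic_disjoint_Ioc le_rfl).mono Set.inter_subset_right Set.inter_subset_right
  have hle : ∀ s t : ℝ, s ≤ t → volume.real (U ∩ Set.Ioc s t) ≤ t - s := fun s t hst => by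
    rw [← Real.volume_real_Ioc_of_le hst]
    exact measureReal_mono Set.inter_subset_right (by simp)
  have heq : ∀ s t : ℝ, s ≤ t → Set.Icc s t ⊆ U → volume.real (U ∩ Set.Ioc s t) = t - s :=
    fun s t hst h => by
    rw [← Real.volume_real_Ioc_of_le hst,
      Set.inter_eq_right.2 (Set.Ioc_subset_Icc_self.trans h)]
  refine ⟨fun t => t - volume.real (U ∩ Set.Iic t), fun s t => ?_, fun t => ?_, fun t ht => ?_⟩
  · wlog hst : s ≤ t generalizing s t
    · rw [abs_sub_comm, abs_sub_comm s]
      exact this t s (le_of_not_ge hst)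
    have h1 := hle s t hst
    have h2 : 0 ≤ volume.real (U ∩ Set.Ioc s t) := measureReal_nonneg
    simp only
    rw [hsplit s t hst, abs_of_nonpos (sub_nonpos.2 hst), abs_of_nonpos] <;> linarith
  · rw [sub_sub_cancel_left, abs_neg, abs_of_nonneg measureReal_nonneg]
    refine ENNReal.toReal_le_of_le_ofReal hε.le ?_
    exact (measure_mono Set.inter_subset_left).trans hUε.le
  · obtain ⟨r, hr, hrU⟩ := Metric.isOpen_iff.1 hU t (hKU ht)
    filter_upwards [Metric.ball_mem_nhds t hr] with s hs
    have hsub : Set.uIcc s t ⊆ U :=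
      ((convex_ball t r).ordConnected.uIcc_subset hs (Metric.mem_ball_self hr)).trans hrU
    rcases le_total s t with h | h
    · rw [hsplit s t h, heq s t h (by rwa [Set.uIcc_of_le h] at hsub)]; ring
    · rw [hsplit t s h, heq t s h (by rwa [Set.uIcc_of_ge h] at hsub)]; ring

variable {M : Type u} [MetricSpace M] {z : M}

theorem exists_locConst_near_of_nullImage {f : Lip0 z} (hf : f ∈ nullImageLip0 z) {ε : ℝ}
    (hε : 0 < ε) : ∃ g ∈ locConstLip0 z, ‖g‖ ≤ ‖f‖ ∧ ∀ x y, |(g x - g y) - (f x - f y)| ≤ ε := by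
  obtain ⟨φ, hφ1, hφ2, hφ3⟩ := Real.exists_short_map_locally_constant hf (half_pos hε)
  obtain ⟨g, hg, hgn⟩ := Lip0.exists_eq_sub z (f := fun x => φ (f x)) (norm_nonneg f)
    fun x y => (hφ1 _ _).trans (f.abs_sub_le x y)
  refine ⟨g, IsLocallyConstant.of_eventually_eq fun x => ?_, hgn, fun x y => ?_⟩
  · filter_upwards [(f.continuous.tendsto x).eventually (hφ3 _ ⟨x, rfl⟩)] with y hy
    rw [hg, hg, hy]
  · rw [hg, hg, show φ (f x) - φ (f z) - (φ (f y) - φ (f z)) - (f x - f y)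
      = (φ (f x) - f x) - (φ (f y) - f y) by ring]
    have := abs_sub (φ (f x) - f x) (φ (f y) - f y)
    linarith [hφ2 (f x), hφ2 (f y)]

theorem SeparatesPointsUniformly.locConst_of_nullImage
    (h : SeparatesPointsUniformly (nullImageLip0 z)) :
    SeparatesPointsUniformly (locConstLip0 z) := by
  obtain ⟨C, hC, h⟩ := h
  refine ⟨2 * C, by linarith, fun x y hxy => ?_⟩
  have hd := dist_pos.2 hxy
  obtain ⟨f, hf, hfC, hfd⟩ := h x y hxy
  obtain ⟨g, hg, hgf, hga⟩ := exists_locConst_near_of_nullImage hf (half_pos hd)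
  have h1 : dist x y / 2 ≤ |g x - g y| := by
    have h2 := abs_sub_abs_le_abs_sub (f x - f y) (g x - g y)
    rw [abs_sub_comm (f x - f y)] at h2
    linarith [hga x y]
  have h0 : 0 < |g x - g y| := by linarith
  refine ⟨(dist x y / |g x - g y|) • g, ?_, ?_, ?_⟩
  · exact hg.comp (fun t => (dist x y / |g x - g y|) * t)
  · rw [norm_smul, Real.norm_of_nonneg (by positivity)]
    have : dist x y / |g x - g y| ≤ 2 := by rw [div_le_iff₀ h0]; linarith
    gcongr
    linarith
  · rw [Lip0.smul_apply, Lip0.smul_apply, ← mul_sub, abs_mul, abs_of_nonneg (by positivity)]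
    field_simp

theorem WeakStarDense.locConst_of_nullImage (h : WeakStarDense (nullImageLip0 z)) :
    WeakStarDense (locConstLip0 z) := by
  suffices ∀ f ∈ nullImageLip0 z, f ∈ closure (X := WeakBilin (lipPairing z)) (locConstLip0 z) from
    Dense.of_closure (h.mono this)
  intro f hf
  choose g hg hgn hga using fun n : ℕ =>
    exists_locConst_near_of_nullImage hf (Nat.one_div_pos_of_nat (α := ℝ) (n := n))
  refine mem_weakStarClosure_of_tendsto (l := atTop) hg hgn fun x => ?_
  rw [tendsto_iff_dist_tendsto_zero]
  refine squeeze_zero (fun _ => dist_nonneg) (fun n => ?_) tendsto_one_div_add_atTop_nhds_zero_nat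
  simpa [Real.dist_eq, Lip0.map_base] using hga n x z

theorem locConstLip0_subset_nullImageLip0 [CompactSpace M] (z : M) :
    locConstLip0 z ⊆ nullImageLip0 z := fun _ hf =>
  Set.Finite.measure_zero (IsLocallyConstant.range_finite hf) _

end Flattening

section Interpolation

variable {M : Type u} [MetricSpace M] {z : M}

theorem abs_sup'_sub_sup'_le {ι : Type*} {s : Finset ι} (hs : s.Nonempty) {a b : ι → ℝ} {c : ℝ}
    (h : ∀ i ∈ s, |a i - b i| ≤ c) : |s.sup' hs a - s.sup' hs b| ≤ c := by
  rw [abs_sub_le_iff, sub_le_iff_le_add, sub_le_iff_le_add]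
  constructor <;> refine Finset.sup'_le _ _ fun i hi => ?_
  · linarith [Finset.le_sup' b hi, (abs_sub_le_iff.1 (h i hi)).1]
  · linarith [Finset.le_sup' a hi, (abs_sub_le_iff.1 (h i hi)).2]

theorem abs_inf'_sub_inf'_le {ι : Type*} {s : Finset ι} (hs : s.Nonempty) {a b : ι → ℝ} {c : ℝ}
    (h : ∀ i ∈ s, |a i - b i| ≤ c) : |s.inf' hs a - s.inf' hs b| ≤ c := by
  rw [abs_sub_le_iff, sub_le_comm, sub_le_comm (a := s.inf' hs b)]
  constructor <;> refine Finset.le_inf' _ _ fun i hi => ?_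
  · linarith [Finset.inf'_le a hi, (abs_sub_le_iff.1 (h i hi)).1]
  · linarith [Finset.inf'_le b hi, (abs_sub_le_iff.1 (h i hi)).2]

theorem exists_locConst_eq_on_pair {C : ℝ} (hC : 1 ≤ C)
    (h : ∀ x y : M, x ≠ y → ∃ f ∈ locConstLip0 z, ‖f‖ ≤ C ∧ |f x - f y| = dist x y)
    (g : Lip0 z) (p q : M) : ∃ k : M → ℝ, IsLocallyConstant k ∧
      (∀ x y, |k x - k y| ≤ C * ‖g‖ * dist x y) ∧ k p = g p ∧ k q = g q := by
  rcases eq_or_ne p q with rfl | hpq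
  · refine ⟨fun _ => g p, IsLocallyConstant.const _, fun x y => ?_, rfl, rfl⟩
    rw [sub_self, abs_zero]
    positivity
  obtain ⟨f, hf, hfC, hfd⟩ := h p q hpq
  have hd := dist_pos.2 hpq
  have h0 : f q - f p ≠ 0 := by
    rw [← abs_pos, abs_sub_comm, hfd]; exact hd
  refine ⟨fun u => g p + (g q - g p) / (f q - f p) * (f u - f p),
    hf.comp fun t => g p + (g q - g p) / (f q - f p) * (t - f p), fun x y => ?_, by simp, ?_⟩
  · have h1 : |(g q - g p) / (f q - f p)| ≤ ‖g‖ := by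
      rw [abs_div, abs_sub_comm (f q), hfd, abs_sub_comm, div_le_iff₀ hd]
      exact g.abs_sub_le p q
    rw [show g p + (g q - g p) / (f q - f p) * (f x - f p)
      - (g p + (g q - g p) / (f q - f p) * (f y - f p))
      = (g q - g p) / (f q - f p) * (f x - f y) by ring, abs_mul]
    calc _ ≤ ‖g‖ * (C * dist x y) := by
          gcongr
          exact (f.abs_sub_le x y).trans (by gcongr)
      _ = _ := by ring
  · simp only
    rw [div_mul_cancel₀ _ h0]; ring

theorem exists_locConst_eqOn_finset {C : ℝ} (hC : 1 ≤ C)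
    (h : ∀ x y : M, x ≠ y → ∃ f ∈ locConstLip0 z, ‖f‖ ≤ C ∧ |f x - f y| = dist x y)
    (g : Lip0 z) {E : Finset M} (hz : z ∈ E) :
    ∃ f ∈ locConstLip0 z, ‖f‖ ≤ C * ‖g‖ ∧ ∀ x ∈ E, f x = g x := by
  have hE : E.Nonempty := ⟨z, hz⟩
  choose k hk hkL hkp hkq using exists_locConst_eq_on_pair hC h g
  have hval : ∀ x ∈ E, E.sup' hE (fun p => E.inf' hE fun q => k p q x) = g x := by
    intro x hx
    refine le_antisymm (Finset.sup'_le _ _ fun p _ => ?_) ?_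
    · exact (Finset.inf'_le _ hx).trans (hkq p x).le
    · refine le_trans ?_ (Finset.le_sup' _ hx)
      exact Finset.le_inf' _ _ fun q _ => (hkp x q).ge
  obtain ⟨f, hf, hfn⟩ := Lip0.exists_eq_sub z
    (f := fun x => E.sup' hE (fun p => E.inf' hE fun q => k p q x)) (C := C * ‖g‖)
    (by positivity) fun x y => abs_sup'_sub_sup'_le hE fun p _ =>
      abs_inf'_sub_inf'_le hE fun q _ => hkL p q x y
  refine ⟨f, IsLocallyConstant.of_eventually_eq fun x => ?_, hfn, fun x hx => ?_⟩
  · have : ∀ᶠ y in 𝓝 x, ∀ p ∈ E, ∀ q ∈ E, k p q y = k p q x := by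
      simp only [Filter.eventually_all_finset]
      exact fun p _ q _ => (hk p q).eventually_eq x
    filter_upwards [this] with y hy
    rw [hf, hf]
    congr 1
    exact Finset.sup'_congr _ rfl fun p hp => Finset.inf'_congr _ rfl fun q hq => hy p hp q hq
  · rw [hf, hval x hx, hval z hz, g.map_base, sub_zero]

theorem SeparatesPointsUniformly.weakStarDense
    (h : SeparatesPointsUniformly (locConstLip0 z)) : WeakStarDense (locConstLip0 z) := by
  classical
  obtain ⟨C, hC, h⟩ := h
  intro g
  choose f hf hfn hfe using fun E : Finset M =>
    exists_locConst_eqOn_finset hC h g (Finset.mem_insert_self z E)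
  refine mem_weakStarClosure_of_tendsto (l := atTop) hf hfn fun x => ?_
  refine tendsto_const_nhds.congr' ?_
  filter_upwards [eventually_ge_atTop {x}] with E hE
  exact (hfe E x (Finset.mem_insert_of_mem (hE (Finset.mem_singleton_self x)))).symm

end Interpolation

section JumpMeasure

open CompactlySupported

theorem ContinuousMap.exists_measure_of_nonneg {X : Type*} [TopologicalSpace X] [CompactSpace X]
    [T2Space X] [MeasurableSpace X] [BorelSpace X] (Λ : C(X, ℝ) →ₗ[ℝ] ℝ)
    (hΛ : ∀ h, 0 ≤ h → 0 ≤ Λ h) :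
    ∃ ν : Measure X, ν Set.univ ≤ ENNReal.ofReal (Λ 1) ∧ ∀ h : C(X, ℝ), ∫ x, h x ∂ν = Λ h := by
  let Φ : C_c(X, ℝ) →ₗ[ℝ] ℝ :=
    { toFun := fun h => Λ h.toContinuousMap
      map_add' := fun f g => map_add Λ f.toContinuousMap g.toContinuousMap
      map_smul' := fun c f => map_smul Λ c f.toContinuousMap }
  let Ψ : C_c(X, ℝ) →ₚ[ℝ] ℝ := PositiveLinearMap.mk₀ Φ fun h hh => hΛ h.toContinuousMap hh
  refine ⟨RealRMK.rieszMeasure Ψ, ?_, fun h => ?_⟩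
  · exact RealRMK.rieszMeasure_le_of_eq_one Ψ
      (f := CompactlySupportedContinuousMap.continuousMapEquiv 1) (fun _ => zero_le_one)
      isCompact_univ fun _ _ => rfl
  · exact RealRMK.integral_rieszMeasure Ψ (CompactlySupportedContinuousMap.continuousMapEquiv h)

variable {M : Type u} [MetricSpace M] {z : M}

variable (z) in
/-- The subspace of locally constant functions. -/
def locConstSubmodule : Submodule ℝ (Lip0 z) where
  carrier := locConstLip0 z
  add_mem' hf hg := IsLocallyConstant.add hf hg
  zero_mem' := IsLocallyConstant.const 0
  smul_mem' c _ hf := hf.comp fun t => c * t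

/-- The difference quotient of a locally constant function is continuous on the whole square. -/
noncomputable def slopeMap : locConstSubmodule z →ₗ[ℝ] C(M × M, ℝ) where
  toFun f := ⟨fun p => ((f : Lip0 z) p.1 - (f : Lip0 z) p.2) / dist p.1 p.2, by
    have hf : IsLocallyConstant (f : Lip0 z) := f.2
    refine continuous_iff_continuousAt.2 fun ⟨u, v⟩ => ?_
    rcases eq_or_ne u v with rfl | huv
    · refine (continuousAt_const (y := (0 : ℝ))).congr ?_
      filter_upwards [(hf.eventually_eq u).prod_nhds (hf.eventually_eq u)] with p hp
      rw [hp.1, hp.2, sub_self, zero_div]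
    · have hc := (f : Lip0 z).continuous
      exact ContinuousAt.div (by fun_prop) (by fun_prop) (dist_ne_zero.2 huv)⟩
  map_add' f g := by
    ext p
    simp only [Submodule.coe_add, Lip0.add_apply, ContinuousMap.coe_mk, ContinuousMap.add_apply]
    ring
  map_smul' c f := by
    ext p
    simp only [Submodule.coe_smul, Lip0.smul_apply, ContinuousMap.coe_mk, ContinuousMap.smul_apply,
      smul_eq_mul, RingHom.id_apply]
    ring

theorem norm_le_norm_slopeMap_sup_zero [CompactSpace M] (f : locConstSubmodule z) :
    ‖(f : Lip0 z)‖ ≤ ‖slopeMap f ⊔ 0‖ := by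
  have key : ∀ u v, (f : Lip0 z) u - (f : Lip0 z) v ≤ ‖slopeMap f ⊔ 0‖ * dist u v := by
    intro u v
    rcases eq_or_ne u v with rfl | huv
    · simp
    · rw [← div_le_iff₀ (dist_pos.2 huv)]
      calc _ ≤ (slopeMap f ⊔ 0) (u, v) := le_sup_left
        _ ≤ ‖(slopeMap f ⊔ 0) (u, v)‖ := Real.le_norm_self _
        _ ≤ _ := ContinuousMap.norm_coe_le_norm _ _
  refine Lip0.norm_le (norm_nonneg _) fun u v => abs_sub_le_iff.2 ⟨key u v, ?_⟩
  rw [dist_comm]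
  exact key v u

theorem ContinuousMap.norm_le_norm_of_nonneg {X : Type*} [TopologicalSpace X] [CompactSpace X]
    {f g : C(X, ℝ)} (hf : 0 ≤ f) (hfg : f ≤ g) : ‖f‖ ≤ ‖g‖ :=
  (ContinuousMap.norm_le _ (norm_nonneg _)).2 fun x => by
    rw [Real.norm_of_nonneg (show 0 ≤ f x from hf x)]
    exact (hfg x).trans ((Real.le_norm_self _).trans (g.norm_coe_le_norm x))

/-- A functional on `s_0(M)` given by an increment of small norm is induced by a positive measure
of small mass on the square. -/
theorem exists_jumpMeasure [CompactSpace M] [MeasurableSpace M] [BorelSpace M] {x y : M}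
    {c : ℝ} (hc : 0 ≤ c) (h : ∀ f ∈ locConstLip0 z, |f x - f y| ≤ c * ‖f‖) :
    ∃ ν : Measure (M × M), ν Set.univ ≤ ENNReal.ofReal c ∧
      ∀ f : locConstSubmodule z, ∫ p, slopeMap f p ∂ν = (f : Lip0 z) x - (f : Lip0 z) y := by
  let L : C(M × M, ℝ) →ₗ[ℝ] ℝ :=
    { toFun := fun k => dist x y * k (x, y)
      map_add' := fun a b => mul_add _ _ _
      map_smul' := fun t a => mul_left_comm _ _ _ }
  have hL : ∀ f : locConstSubmodule z, L (slopeMap f) = (f : Lip0 z) x - (f : Lip0 z) y := by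
    intro f
    change dist x y * (((f : Lip0 z) x - (f : Lip0 z) y) / dist x y) = _
    rcases eq_or_ne x y with rfl | hxy
    · simp
    · exact mul_div_cancel₀ _ (dist_ne_zero.2 hxy)
  obtain ⟨Λ, hΛ, hΛN⟩ := exists_extension_of_le_sublinear
    ⟨LinearMap.range (slopeMap (z := z)), L.domRestrict _⟩ (fun k => c * ‖k ⊔ 0‖)
    (fun t ht k => by
      have : t • k ⊔ 0 = t • (k ⊔ 0) := by
        ext p
        simp [mul_max_of_nonneg _ _ ht.le]
      rw [this, norm_smul, Real.norm_of_nonneg ht.le]; ring)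
    (fun a b => by
      rw [← mul_add]
      refine mul_le_mul_of_nonneg_left ((ContinuousMap.norm_le_norm_of_nonneg le_sup_right ?_).trans
        (norm_add_le _ _)) hc
      exact sup_le (add_le_add le_sup_left le_sup_left) (add_nonneg le_sup_right le_sup_right))
    (by
      rintro ⟨_, f, rfl⟩
      change L (slopeMap f) ≤ _
      rw [hL]
      exact (le_abs_self _).trans ((h f f.2).trans
        (mul_le_mul_of_nonneg_left (norm_le_norm_slopeMap_sup_zero f) hc)))
  obtain ⟨ν, hν, hνΛ⟩ := ContinuousMap.exists_measure_of_nonneg Λ fun k hk => by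
    have h1 := hΛN (-k)
    rw [sup_eq_right.2 (neg_nonpos.2 hk), norm_zero, mul_zero, map_neg] at h1
    linarith
  refine ⟨ν, hν.trans (ENNReal.ofReal_le_ofReal ?_), fun f => ?_⟩
  · refine (hΛN 1).trans (mul_le_of_le_one_right hc ?_)
    refine (ContinuousMap.norm_le _ zero_le_one).2 fun p => ?_
    simp
  · rw [hνΛ, ← hL]
    exact hΛ ⟨slopeMap f, f, rfl⟩

theorem Submodule.integral_mem {X E : Type*} [MeasurableSpace X] {ν : Measure X}
    [IsFiniteMeasure ν] [NormedAddCommGroup E] [NormedSpace ℝ E] [CompleteSpace E]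
    {p : Submodule ℝ E} (hp : IsClosed (p : Set E)) {f : X → E} (hf : Integrable f ν)
    (hfp : ∀ x, f x ∈ p) : ∫ x, f x ∂ν ∈ p := by
  rcases eq_or_ne ν 0 with rfl | hν
  · simp
  · have : NeZero ν := ⟨hν⟩
    rw [← measure_smul_average]
    exact p.smul_mem _ (p.convex.average_mem hp (Eventually.of_forall hfp) hf)

variable (z) in
/-- The elementary molecule `(δ(u) - δ(v)) / d(u, v)`. -/
noncomputable def molecule (p : M × M) : StrongDual ℝ (Lip0 z) :=
  (dist p.1 p.2)⁻¹ • (evalAt z p.1 - evalAt z p.2)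

theorem molecule_mem (p : M × M) : molecule z p ∈ LipFree z :=
  (LipFree z).smul_mem _ (sub_mem (evalAt_mem z p.1) (evalAt_mem z p.2))

theorem molecule_apply (p : M × M) (f : Lip0 z) :
    molecule z p f = (f p.1 - f p.2) / dist p.1 p.2 := by
  change (dist p.1 p.2)⁻¹ * (f p.1 - f p.2) = _
  rw [div_eq_inv_mul]

theorem norm_molecule_le (p : M × M) : ‖molecule z p‖ ≤ 1 := by
  rw [molecule, norm_smul, norm_inv, Real.norm_of_nonneg dist_nonneg]
  exact inv_mul_le_one_of_le₀ (LipFree.norm_evalAt_sub_le p.1 p.2) dist_nonneg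

theorem stronglyMeasurable_molecule [CompactSpace M] [MeasurableSpace M] [BorelSpace M] :
    StronglyMeasurable (molecule z) := by
  have hδ : Continuous (evalAt z) := by
    refine (LipschitzWith.of_dist_le_mul (K := 1) fun x y => ?_).continuous
    rw [NNReal.coe_one, one_mul, dist_eq_norm]
    exact LipFree.norm_evalAt_sub_le x y
  have h1 : StronglyMeasurable fun p : M × M => (dist p.1 p.2)⁻¹ :=
    (continuous_dist.measurable.inv).stronglyMeasurable
  have h2 : StronglyMeasurable fun p : M × M => evalAt z p.1 - evalAt z p.2 :=
    ((hδ.comp continuous_fst).sub (hδ.comp continuous_snd)).stronglyMeasurable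
  exact h1.smul h2

/-- If `s_0(M)` separates the points of `F(M)`, it separates the points of `M` uniformly. -/
theorem separatesPointsUniformly_of_annihilator_eq_zero [CompactSpace M]
    (h : ∀ μ ∈ LipFree z, (∀ f ∈ locConstLip0 z, μ f = 0) → μ = 0) :
    SeparatesPointsUniformly (locConstLip0 z) := by
  borelize M
  by_contra hsep
  have hsep' : ¬ ∀ x y : M, x ≠ y → ∃ f ∈ locConstLip0 z, ‖f‖ ≤ 2 ∧ |f x - f y| = dist x y :=
    fun h' => hsep ⟨2, one_le_two, h'⟩
  push Not at hsep'
  obtain ⟨x, y, hxy, hne⟩ := hsep'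
  have hd := dist_pos.2 hxy
  have hsmall : ∀ f ∈ locConstLip0 z, |f x - f y| ≤ dist x y / 2 * ‖f‖ := by
    intro f hf
    by_contra! hlt
    have h0 : 0 < |f x - f y| := lt_of_le_of_lt (by positivity) hlt
    refine hne ((dist x y / |f x - f y|) • f) ((locConstSubmodule z).smul_mem _ hf) ?_ ?_
    · rw [norm_smul, Real.norm_of_nonneg (by positivity), div_mul_eq_mul_div, div_le_iff₀ h0]
      linarith
    · rw [Lip0.smul_apply, Lip0.smul_apply, ← mul_sub, abs_mul, abs_of_nonneg (by positivity)]
      field_simp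
  obtain ⟨ν, hν, hνf⟩ := exists_jumpMeasure (by positivity) hsmall
  have : IsFiniteMeasure ν := ⟨hν.trans_lt ENNReal.ofReal_lt_top⟩
  have hint : Integrable (molecule z) ν :=
    Integrable.of_bound stronglyMeasurable_molecule.aestronglyMeasurable 1
      (Eventually.of_forall norm_molecule_le)
  let ξ : StrongDual ℝ (Lip0 z) := ∫ p, molecule z p ∂ν
  have hξ : ∀ f : Lip0 z, ξ f = ∫ p, (f p.1 - f p.2) / dist p.1 p.2 ∂ν := by
    intro f
    rw [show ξ f = ContinuousLinearMap.apply ℝ ℝ f ξ from rfl,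
      ← (ContinuousLinearMap.apply ℝ ℝ f).integral_comp_comm hint]
    exact integral_congr_ae (Eventually.of_forall fun p => molecule_apply p f)
  have hξm : ξ ∈ LipFree z :=
    Submodule.integral_mem (Submodule.isClosed_topologicalClosure _) hint molecule_mem
  have hξn : ‖ξ‖ ≤ dist x y / 2 := by
    refine (norm_integral_le_of_norm_le_const (Eventually.of_forall norm_molecule_le)).trans ?_
    rw [one_mul]
    exact ENNReal.toReal_le_of_le_ofReal (by positivity) hν
  have hzero := h (evalAt z x - evalAt z y - ξ)
    (sub_mem (sub_mem (evalAt_mem z x) (evalAt_mem z y)) hξm) fun f hf => by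
      change f x - f y - ξ f = 0
      rw [hξ, sub_eq_zero]
      exact (hνf ⟨f, hf⟩).symm
  have h1 := LipFree.dist_le_norm_evalAt_sub (z := z) x y
  rw [sub_eq_zero.1 hzero] at h1
  linarith

end JumpMeasure

section Injectivity

variable {M : Type u} [MetricSpace M] {z : M}

theorem IsLocallyConstant.exists_lipschitz_factor [CompactSpace M] {N : Type*} [MetricSpace N]
    {k : M → ℝ} (hk : IsLocallyConstant k) {f : M → N} (hf : Continuous f)
    (hinj : Function.Injective f) :
    ∃ g : N → ℝ, (∃ K : NNReal, LipschitzWith K g) ∧ ∀ x, g (f x) = k x := by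
  have hkc := hk.continuous
  have hbound : ∃ K : ℝ, 0 ≤ K ∧ ∀ u v, |k u - k v| ≤ K * dist (f u) (f v) := by
    have hq : Continuous fun p : M × M => |k p.1 - k p.2| / dist (f p.1) (f p.2) := by
      refine continuous_iff_continuousAt.2 fun ⟨u, v⟩ => ?_
      rcases eq_or_ne u v with rfl | huv
      · refine (continuousAt_const (y := (0 : ℝ))).congr ?_
        filter_upwards [(hk.eventually_eq u).prod_nhds (hk.eventually_eq u)] with p hp
        rw [hp.1, hp.2, sub_self, abs_zero, zero_div]
      · exact ContinuousAt.div (by fun_prop) (by fun_prop) (dist_ne_zero.2 (hinj.ne huv))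
    obtain ⟨K, hK⟩ := (isCompact_range hq).bddAbove
    refine ⟨max K 0, le_max_right _ _, fun u v => ?_⟩
    rcases eq_or_ne u v with rfl | huv
    · simp
    · rw [← div_le_iff₀ (dist_pos.2 (hinj.ne huv))]
      exact le_max_of_le_left (hK ⟨(u, v), rfl⟩)
  obtain ⟨K, hK0, hK⟩ := hbound
  have hL : LipschitzOnWith K.toNNReal (Function.extend f k 0) (Set.range f) := by
    refine LipschitzOnWith.of_dist_le_mul ?_
    rintro _ ⟨u, rfl⟩ _ ⟨v, rfl⟩
    rw [hinj.extend_apply, hinj.extend_apply, Real.coe_toNNReal K hK0]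
    exact hK u v
  obtain ⟨g, hg, hge⟩ := hL.extend_real
  exact ⟨g, ⟨_, hg⟩, fun x => by rw [← hge ⟨x, rfl⟩, hinj.extend_apply]⟩

theorem lipLinInjective_of_annihilator_eq_zero [CompactSpace M]
    (h : ∀ μ ∈ LipFree z, (∀ f ∈ locConstLip0 z, μ f = 0) → μ = 0) :
    LipLinInjective.{u, v} z := by
  intro N _ w f hf hinj
  refine (injective_iff_map_eq_zero _).2 fun μ hμ => Subtype.ext (h μ μ.2 fun k hk => ?_)
  obtain ⟨g, hgL, hg⟩ :=
    IsLocallyConstant.exists_lipschitz_factor hk hf.1.choose_spec.continuous hinj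
  let G : Lip0 w := ⟨g, hgL, by rw [← hf.2, hg, k.map_base]⟩
  have hG : compOp hf G = k := DFunLike.ext _ _ hg
  rw [← hG]
  exact DFunLike.congr_fun (congrArg Subtype.val hμ) G

theorem SeparatesPointsUniformly.totallyDisconnectedSpace
    (h : SeparatesPointsUniformly (locConstLip0 z)) : TotallyDisconnectedSpace M := by
  obtain ⟨C, -, h⟩ := h
  refine ⟨fun s _ hs x hx y hy => ?_⟩
  by_contra hxy
  obtain ⟨f, hf, -, hfd⟩ := h x y hxy
  rw [IsLocallyConstant.apply_eq_of_isPreconnected hf hs hx hy, sub_self, abs_zero] at hfd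
  exact hxy (dist_eq_zero.1 hfd.symm)

end Injectivity

section GapMetric

variable {M : Type u} [MetricSpace M]

/-- The sizes of the gaps of `M` between `x` and `y`. -/
def gapSet (x y : M) : Set ℝ :=
  {ε | ∃ A : Set M, x ∈ A ∧ y ∉ A ∧ ∀ a ∈ A, ∀ b ∉ A, ε ≤ dist a b}

/-- The largest gap of `M` between `x` and `y`. -/
noncomputable def gapDist (x y : M) : ℝ := sSup (gapSet x y)

theorem le_dist_of_mem_gapSet {x y : M} {ε : ℝ} (h : ε ∈ gapSet x y) : ε ≤ dist x y := by
  obtain ⟨A, hx, hy, h⟩ := h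
  exact h x hx y hy

theorem bddAbove_gapSet (x y : M) : BddAbove (gapSet x y) :=
  ⟨dist x y, fun _ => le_dist_of_mem_gapSet⟩

theorem gapDist_le_dist (x y : M) : gapDist x y ≤ dist x y :=
  Real.sSup_le (fun _ => le_dist_of_mem_gapSet) dist_nonneg

theorem gapDist_self (x : M) : gapDist x x = 0 := by
  have : gapSet x x = ∅ :=
    Set.eq_empty_of_forall_notMem fun ε ⟨_, h1, h2, _⟩ => h2 h1
  rw [gapDist, this, Real.sSup_empty]

theorem gapSet_subset_comm (x y : M) : gapSet x y ⊆ gapSet y x := by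
  rintro ε ⟨A, hx, hy, h⟩
  refine ⟨Aᶜ, hy, not_not_intro hx, fun a ha b hb => ?_⟩
  rw [dist_comm]
  exact h b (not_not.1 hb) a ha

theorem gapDist_comm (x y : M) : gapDist x y = gapDist y x :=
  congrArg sSup ((gapSet_subset_comm x y).antisymm (gapSet_subset_comm y x))

theorem le_gapDist {x y : M} {ε : ℝ} (h : ε ∈ gapSet x y) : ε ≤ gapDist x y :=
  le_csSup (bddAbove_gapSet x y) h

theorem gapDist_nonneg (x y : M) : 0 ≤ gapDist x y := by
  rcases eq_or_ne x y with rfl | hxy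
  · rw [gapDist_self]
  · exact le_gapDist ⟨{x}, rfl, hxy.symm, fun _ _ _ _ => dist_nonneg⟩

theorem gapDist_triangle (x y w : M) : gapDist x w ≤ gapDist x y + gapDist y w := by
  refine Real.sSup_le ?_ (add_nonneg (gapDist_nonneg _ _) (gapDist_nonneg _ _))
  rintro ε ⟨A, hx, hw, h⟩
  by_cases hy : y ∈ A
  · exact (le_gapDist ⟨A, hy, hw, h⟩).trans (le_add_of_nonneg_left (gapDist_nonneg _ _))
  · exact (le_gapDist ⟨A, hx, hy, h⟩).trans (le_add_of_nonneg_right (gapDist_nonneg _ _))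

theorem gapDist_pos [CompactSpace M] [TotallyDisconnectedSpace M] {x y : M} (hxy : x ≠ y) :
    0 < gapDist x y := by
  obtain ⟨U, hU, hx, hy⟩ := exists_isClopen_of_totally_separated hxy
  obtain ⟨p, hp, hmin⟩ := (hU.isClosed.isCompact.prod hU.compl.isClosed.isCompact).exists_isMinOn
    ⟨(x, y), hx, hy⟩ (continuous_dist (α := M)).continuousOn
  have hpos : 0 < dist p.1 p.2 := dist_pos.2 fun h => hp.2 (h ▸ hp.1)
  exact hpos.trans_le (le_gapDist ⟨U, hx, hy, fun a ha b hb => hmin (a := (a, b)) ⟨ha, hb⟩⟩)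

/-- A copy of `M`, to be metrised by the size of gaps. -/
structure GapSpace (M : Type u) : Type max u v where
  /-- the underlying point -/
  point : M

theorem gapSpace_mk_surjective {M : Type u} : Function.Surjective (GapSpace.mk.{u, v} (M := M)) :=
  fun a => ⟨a.point, rfl⟩

variable [CompactSpace M] [TotallyDisconnectedSpace M]

noncomputable instance : MetricSpace (GapSpace.{u, v} M) where
  dist a b := gapDist a.point b.point
  dist_self a := gapDist_self _
  dist_comm a b := gapDist_comm _ _
  dist_triangle a b c := gapDist_triangle _ _ _
  eq_of_dist_eq_zero := fun {a b} h => by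
    by_contra hab
    exact (gapDist_pos fun h' => hab (by cases a; cases b; cases h'; rfl)).ne' h

theorem lipschitzWith_gapSpace_mk : LipschitzWith 1 (GapSpace.mk.{u, v} (M := M)) :=
  LipschitzWith.of_dist_le_mul fun x y => by
    rw [NNReal.coe_one, one_mul]
    exact gapDist_le_dist x y

instance : CompactSpace (GapSpace.{u, v} M) :=
  gapSpace_mk_surjective.compactSpace lipschitzWith_gapSpace_mk.continuous

theorem GapSpace.separatesPointsUniformly (w : GapSpace.{u, v} M) :
    SeparatesPointsUniformly (locConstLip0 w) := by
  classical
  refine ⟨2, one_le_two, fun a b hab => ?_⟩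
  have hd : 0 < dist a b := dist_pos.2 hab
  obtain ⟨ε, hε, hlt⟩ := exists_lt_of_lt_csSup
    (⟨0, {a.point}, rfl, fun h => hab (by cases a; cases b; cases h; rfl),
      fun _ _ _ _ => dist_nonneg⟩ : (gapSet a.point b.point).Nonempty)
    (half_lt_self hd : dist a b / 2 < gapDist a.point b.point)
  obtain ⟨A, ha, hb, hA⟩ := hε
  have hgap : ∀ u v : GapSpace.{u, v} M, u.point ∈ A → v.point ∉ A → dist a b / 2 ≤ dist u v :=
    fun u v hu hv => hlt.le.trans (le_gapDist ⟨A, hu, hv, hA⟩)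
  let k : GapSpace.{u, v} M → ℝ := fun u => if u.point ∈ A then dist a b else 0
  have hk : ∀ u v, k u = k v ∨ |k u - k v| = dist a b ∧ dist a b / 2 ≤ dist u v := by
    intro u v
    by_cases hu : u.point ∈ A <;> by_cases hv : v.point ∈ A
    · simp [k, hu, hv]
    · exact Or.inr ⟨by simp [k, hu, hv], hgap u v hu hv⟩
    · exact Or.inr ⟨by simp [k, hu, hv], by rw [dist_comm u v]; exact hgap v u hv hu⟩
    · simp [k, hu, hv]
  obtain ⟨f, hf, hfn⟩ := Lip0.exists_eq_sub w (f := k) zero_le_two fun u v => by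
    rcases hk u v with h | h
    · rw [h, sub_self, abs_zero]; positivity
    · linarith [h.1, h.2]
  refine ⟨f, IsLocallyConstant.of_eventually_eq fun u => ?_, hfn, ?_⟩
  · filter_upwards [Metric.ball_mem_nhds u (half_pos hd)] with v hv
    rw [hf, hf, (hk v u).resolve_right fun h => absurd h.2 (not_le.2 hv)]
  · rw [hf, hf]
    simp [k, ha, hb]

theorem LipLinInjective.annihilator_eq_zero {z : M} (h : LipLinInjective.{u, v} z) :
    ∀ μ ∈ LipFree z, (∀ f ∈ locConstLip0 z, μ f = 0) → μ = 0 := by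
  intro μ hμ hμ0
  have hf : GapSpace.mk.{u, v} ∈ Lip0Maps z (GapSpace.mk.{u, v} z) :=
    ⟨⟨1, lipschitzWith_gapSpace_mk⟩, rfl⟩
  have hinj := h (GapSpace.{u, v} M) _ _ hf fun x y hxy => congrArg GapSpace.point hxy
  have h0 : linearisation hf ⟨μ, hμ⟩ = 0 := Subtype.ext <|
    (GapSpace.separatesPointsUniformly.{u, v} ⟨z⟩).weakStarDense.eq_zero_of_forall
      (dualOp_mem hf hμ) fun g hg => hμ0 (compOp hf g)
        (IsLocallyConstant.comp_continuous (f := GapSpace.mk.{u, v}) hg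
          lipschitzWith_gapSpace_mk.continuous)
  exact congrArg Subtype.val ((injective_iff_map_eq_zero _).1 hinj _ h0)

end GapMetric

theorem theoremt {M : Type u} [MetricSpace M] [CompactSpace M] (z : M) :
    List.TFAE [
      WeakStarDense (locConstLip0 z),
      WeakStarDense (nullImageLip0 z),
      SeparatesPointsUniformly (locConstLip0 z),
      SeparatesPointsUniformly (nullImageLip0 z),
      LipLinInjective.{u, v} z ∧ TotallyDisconnectedSpace M] := by
  tfae_have 1 → 2 := fun h => Dense.mono (locConstLip0_subset_nullImageLip0 z) h
  tfae_have 2 → 1 := WeakStarDense.locConst_of_nullImage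
  tfae_have 3 → 4 := fun ⟨C, hC, h⟩ => ⟨C, hC, fun x y hxy =>
    (h x y hxy).imp fun _ hf => hf.imp_left fun hf => locConstLip0_subset_nullImageLip0 z hf⟩
  tfae_have 4 → 3 := SeparatesPointsUniformly.locConst_of_nullImage
  tfae_have 3 → 1 := SeparatesPointsUniformly.weakStarDense
  tfae_have 1 → 5 := fun h =>
    have ha := fun μ hμ => h.eq_zero_of_forall (μ := μ) hμ
    ⟨lipLinInjective_of_annihilator_eq_zero ha,
      (separatesPointsUniformly_of_annihilator_eq_zero ha).totallyDisconnectedSpace⟩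
  tfae_have 5 → 3 := fun ⟨h, _⟩ =>
    separatesPointsUniformly_of_annihilator_eq_zero h.annihilator_eq_zero
  tfae_finish
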